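/- Let $G$ be a finite simple graph with adjacency matrix $A$ and diagonal degree matrix $D$. For a real number $a$, let $\lambda_2(G,a)$ denote the second largest eigenvalue (counted with multiplicity) of the matrix $aD+A$. The girth of $G$ is the length of a shortest cycle of $G$ ($\infty$ if $G$ is acyclic), and $\tau(G)$ is the maximum number of pairwise edge-disjoint spanning trees contained in $G$. For integers $\delta>0$ and $g\ge 3$ put $t=\lfloor (g-1)/2\rfloor$ and $$n_1^*(\delta,g)=\begin{cases}1+\delta+\sum_{i=2}^{t}(\delta-1)^i, & \text{if } g=2t+1,\\[2pt] 2+2(\delta-1)^t+\sum_{i=1}^{t-1}(\delta-1)^i, & \text{if } g=2t+2,\end{cases}$$ where empty sums are $0$. **Theorem.** Let $g\ge 3$ and $k\ge 2$ be integers, let $a\ge -1$ be a real number, and let $G$ be a finite simple graph with minimum degree $\delta\ge 2k$ and girth $g$. If $$\lambda_2(G,a)<(a+1)\delta-\frac{2k-1}{n_1^*(\delta,g)},$$ then $\tau(G)\ge k$. -/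

import Mathlib

/-- The matrix `a D + A` of a finite simple graph `G`, where `D` is the diagonal matrix of the
vertex degrees and `A` is the adjacency matrix. -/
noncomputable def degAdjMatrix {V : Type*} [Fintype V] [DecidableEq V] (G : SimpleGraph V)
    [DecidableRel G.Adj] (a : ℝ) : Matrix V V ℝ :=
  a • G.degMatrix ℝ + G.adjMatrix ℝ

theorem degAdjMatrix_isHermitian {V : Type*} [Fintype V] [DecidableEq V] (G : SimpleGraph V)
    [DecidableRel G.Adj] (a : ℝ) : (degAdjMatrix G a).IsHermitian := by
  have h : (degAdjMatrix G a).IsSymm := by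
    unfold degAdjMatrix SimpleGraph.degMatrix
    exact ((Matrix.isSymm_diagonal _).smul a).add G.isSymm_adjMatrix
  simpa [Matrix.IsHermitian, Matrix.conjTranspose_eq_transpose_of_trivial] using h.eq

/-- `lambdaDA G a i` is the `i`-th largest eigenvalue `λᵢ(G, a)` of the real symmetric matrix
`a D + A`, counted with multiplicity, for `1 ≤ i ≤ |V|`
(Mathlib's `eigenvalues₀` lists the eigenvalues in non-increasing order, starting at index `0`).
For other values of `i` it is set to `0`. -/
noncomputable def lambdaDA {V : Type*} [Fintype V] [DecidableEq V] (G : SimpleGraph V)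
    [DecidableRel G.Adj] (a : ℝ) (i : ℕ) : ℝ :=
  if h : 1 ≤ i ∧ i ≤ Fintype.card V then
    (degAdjMatrix_isHermitian G a).eigenvalues₀ ⟨i - 1, by omega⟩
  else 0

/-- The function `n₁*(δ, g)`, for `δ > 0` and `g ≥ 3`. With `t = ⌊(g - 1) / 2⌋` it equals
`1 + δ + ∑_{i=2}^{t} (δ - 1)^i` if `g = 2t + 1`, and
`2 + 2 (δ - 1)^t + ∑_{i=1}^{t-1} (δ - 1)^i` if `g = 2t + 2`. -/
noncomputable def nOneStar (δ g : ℕ) : ℝ :=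
  let t : ℕ := (g - 1) / 2
  if g = 2 * t + 1 then
    1 + (δ : ℝ) + ∑ i ∈ Finset.Icc 2 t, ((δ : ℝ) - 1) ^ i
  else
    2 + 2 * ((δ : ℝ) - 1) ^ t + ∑ i ∈ Finset.Icc 1 (t - 1), ((δ : ℝ) - 1) ^ i

/-- `F` is a family of `m` pairwise edge-disjoint spanning trees of `G`. -/
def IsSpanningTreePacking {V : Type*} (G : SimpleGraph V) {m : ℕ}
    (F : Fin m → SimpleGraph V) : Prop :=
  (∀ i, F i ≤ G ∧ (F i).IsTree) ∧
    ∀ i j, i ≠ j → Disjoint (F i).edgeSet (F j).edgeSet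

/-- The spanning tree packing number `τ(G)`: the maximum number of pairwise edge-disjoint
spanning trees contained in `G`. (It is a finite number for a finite graph with at least two
vertices.) -/
noncomputable def treePackingNumber {V : Type*} (G : SimpleGraph V) : ℕ∞ :=
  ⨆ m ∈ {m : ℕ | ∃ F : Fin m → SimpleGraph V, IsSpanningTreePacking G F}, (m : ℕ∞)

/-! By the Nash-Williams–Tutte criterion it suffices that every partition into `p` parts has at
least `k (p - 1)` crossing edges. Let `D c` be the number of edges leaving part `c`. If some
partition fails, then the sum of `2k - D c` over all parts exceeds `2k`.

Let `c₀` be a part minimizing `D`. It is enough that every other part `c` receives at least `2k - D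
c` edges from `c₀`: summing over `c` bounds the sum of these terms by `D c₀`, so the full sum is at
most `2k`, a contradiction. The bound is trivial when `D c ≥ 2k`. Otherwise both parts are left by
fewer than `2k ≤ δ` edges, and a Moore-type count of distance levels (`nOneStar_le_card`) gives each
at least `nOneStar δ g` vertices. Evaluating the quadratic form of `aD + A` on vectors constant on
the two parts then turns the bound on the second eigenvalue into the required edges
(`sub_edgesOut_lt_edgesBetween`).

The criterion itself (`exists_isSpanningTreePacking`) is proved by exchanging edges in a forest
packing with the most edges. -/

namespace SimpleGraph

/-- The subgraph of `G` formed by the edges whose ends lie in different fibres of `f`. -/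
def crossGraph {V ι : Type*} (G : SimpleGraph V) (f : V → ι) : SimpleGraph V :=
  G ⊓ (⊤ : SimpleGraph ι).comap f

theorem crossGraph_adj {V ι : Type*} {G : SimpleGraph V} {f : V → ι} {u v : V} :
    (G.crossGraph f).Adj u v ↔ G.Adj u v ∧ f u ≠ f v := by
  simp [crossGraph]

theorem Reachable.of_forall_adj {V : Type*} {G H : SimpleGraph V}
    (h : ∀ u v, G.Adj u v → H.Reachable u v) {x y : V} (hxy : G.Reachable x y) :
    H.Reachable x y := by
  obtain ⟨p⟩ := hxy
  induction p with
  | nil => exact .rfl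
  | cons hadj _ ih => exact (h _ _ hadj).trans ih

/-! ### Edges against components in graphs and forests. -/

section Counting

variable {V : Type*} [Finite V]

/-- A graph on `n` vertices with `c` components has at least `n - c` edges. -/
theorem card_le_ncard_edgeSet_add_card_connectedComponent (G : SimpleGraph V) :
    Nat.card V ≤ G.edgeSet.ncard + Nat.card G.ConnectedComponent := by
  classical
  have hroot : ∀ v, G.Reachable (G.connectedComponentMk v).out v := fun v =>
    ConnectedComponent.exact (Quot.out_eq (G.connectedComponentMk v))
  set d : V → ℕ := fun v => G.dist (G.connectedComponentMk v).out v with hd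
  have hpar : ∀ v, d v ≠ 0 → ∃ w, G.Adj w v ∧ d w < d v := by
    intro v hv
    obtain ⟨p, hp⟩ := (hroot v).exists_walk_length_eq_dist
    have hnil : ¬ p.Nil := fun hn => hv (by
      rw [hd]; simp only; rw [← hp]; exact Walk.length_eq_zero_iff.mpr hn)
    have hadj := p.adj_penultimate hnil
    refine ⟨p.penultimate, hadj, ?_⟩
    have hc : G.connectedComponentMk p.penultimate = G.connectedComponentMk v :=
      ConnectedComponent.connectedComponentMk_eq_of_adj hadj
    have h1 : d p.penultimate ≤ p.dropLast.length := by
      rw [hd]; simp only; rw [hc]; exact dist_le _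
    have h2 : p.dropLast.length + 1 = p.length := Walk.length_dropLast_add_one hnil
    have h3 : d v = p.length := hp.symm
    omega
  choose! par hadj hlt using hpar
  have hzero : ∀ v, d v = 0 → (G.connectedComponentMk v).out = v := fun v hv =>
    (hroot v).dist_eq_zero_iff.mp hv
  have key : (Set.univ : Set V).ncard ≤
      ({v | d v ≠ 0} : Set V).ncard + ({v | d v = 0} : Set V).ncard := by
    rw [← Set.ncard_union_eq (by
      rw [Set.disjoint_left]; intro v hv hv'; exact hv hv') (Set.toFinite _) (Set.toFinite _)]
    refine Set.ncard_le_ncard (fun v _ => ?_) (Set.toFinite _)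
    by_cases hv : d v = 0
    · exact Or.inr hv
    · exact Or.inl hv
  -- Each non-root is charged to the edge towards its parent. Two vertices sharing that edge would
  -- be parents of each other, against the strict decrease of `d`.
  have h1 : ({v | d v ≠ 0} : Set V).ncard ≤ G.edgeSet.ncard := by
    refine Set.ncard_le_ncard_of_injOn (fun v => s(par v, v)) (fun v hv => hadj v hv) ?_
      (Set.toFinite _)
    intro v hv w hw hvw
    rcases Sym2.eq_iff.mp hvw with ⟨_, h⟩ | ⟨h, h'⟩
    · exact h
    · have a := hlt v hv
      have b := hlt w hw
      rw [h] at a; rw [← h'] at b; omega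
  have h2 : ({v | d v = 0} : Set V).ncard ≤ Nat.card G.ConnectedComponent := by
    rw [← Set.ncard_univ]
    refine Set.ncard_le_ncard_of_injOn G.connectedComponentMk (fun v _ => Set.mem_univ _) ?_
      (Set.toFinite _)
    intro v hv w hw hvw
    rw [← hzero v hv, ← hzero w hw, hvw]
  rw [Set.ncard_univ] at key
  omega

/-- A forest on `n` vertices with `c` components has at most `n - c` edges. -/
theorem IsAcyclic.ncard_edgeSet_add_card_connectedComponent_le {G : SimpleGraph V}
    (hG : G.IsAcyclic) : G.edgeSet.ncard + Nat.card G.ConnectedComponent ≤ Nat.card V := by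
  induction hn : G.edgeSet.ncard generalizing G with
  | zero =>
    have := Nat.card_le_card_of_surjective G.connectedComponentMk
      (fun c => Quot.exists_rep c)
    omega
  | succ n ih =>
    obtain ⟨e, he⟩ := Set.nonempty_of_ncard_ne_zero (s := G.edgeSet) (by omega)
    induction e with | _ u v => ?_
    have hle : G.deleteEdges {s(u, v)} ≤ G := deleteEdges_le _
    have hcard : (G.deleteEdges {s(u, v)}).edgeSet.ncard = n := by
      rw [edgeSet_deleteEdges, Set.ncard_sdiff_singleton_of_mem he, hn]; rfl
    have h1 := ih (hG.anti hle) hcard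
    have hbr : ¬ (G.deleteEdges {s(u, v)}).Reachable u v := by
      exact isAcyclic_iff_forall_isBridge.mp hG he
    -- Deleting a bridge adds a component: `π` is onto but identifies the components of `u` and `v`.
    let π : (G.deleteEdges {s(u, v)}).ConnectedComponent → G.ConnectedComponent :=
      ConnectedComponent.map (Hom.ofLE hle)
    have hsurj : Function.Surjective π := by
      intro c
      obtain ⟨w, rfl⟩ := Quot.exists_rep c
      exact ⟨connectedComponentMk _ w, rfl⟩
    have hninj : ¬ Function.Injective π := by
      intro hinj
      refine hbr (ConnectedComponent.exact (hinj ?_))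
      exact ConnectedComponent.connectedComponentMk_eq_of_adj (G := G) he
    have := Fintype.ofFinite G.ConnectedComponent
    have := Fintype.ofFinite (G.deleteEdges {s(u, v)}).ConnectedComponent
    have h2 := Fintype.card_lt_of_surjective_not_injective π hsurj hninj
    simp only [Nat.card_eq_fintype_card] at h1 ⊢
    omega

end Counting

/-! ### Edge exchange in forest packings and the Nash-Williams–Tutte theorem. -/

section Packing

variable {V : Type*} {k : ℕ}

/-- `F` is a family of pairwise edge-disjoint forests contained in `G`. -/
def IsForestPacking (G : SimpleGraph V) (F : Fin k → SimpleGraph V) : Prop :=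
  (∀ i, F i ≤ G ∧ (F i).IsAcyclic) ∧ ∀ i j, i ≠ j → Disjoint (F i) (F j)

/-- The families obtained from `F` by repeatedly replacing an edge `xy` of one of the forests by
an edge `uv` of `G` outside all of them, whose fundamental cycle runs through `xy`. -/
inductive ExchangeReachable (G : SimpleGraph V) (F : Fin k → SimpleGraph V) :
    (Fin k → SimpleGraph V) → Prop
  | refl : ExchangeReachable G F F
  | step (F' : Fin k → SimpleGraph V) (i : Fin k) (u v x y : V) :
      ExchangeReachable G F F' → G.Adj u v → (∀ j, ¬ (F' j).Adj u v) → (F' i).Adj x y →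
      ¬ (F' i \ edge x y).Reachable u v →
      ExchangeReachable G F (Function.update F' i (F' i \ edge x y ⊔ edge u v))

/-- The graph of the edges of `G` left uncovered by some family exchange-reachable from `F`. -/
def uncoveredGraph (G : SimpleGraph V) (F : Fin k → SimpleGraph V) : SimpleGraph V where
  Adj u v := G.Adj u v ∧ ∃ F', ExchangeReachable G F F' ∧ ∀ j, ¬ (F' j).Adj u v
  symm := ⟨fun _ _ ⟨h, F', hF', hj⟩ => ⟨h.symm, F', hF', fun j hadj => hj j hadj.symm⟩⟩
  loopless := ⟨fun _ h => h.1.ne rfl⟩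

/-- Serves both moves: exchange, with `H` the forest `F i` minus an edge, and augmentation, with `H
= F i`. -/
theorem IsForestPacking.update {G : SimpleGraph V} {F : Fin k → SimpleGraph V}
    (hF : IsForestPacking G F) {i : Fin k} {H : SimpleGraph V} {u v : V} (hH : H ≤ F i)
    (huv : G.Adj u v) (hout : ∀ j, ¬ (F j).Adj u v) (hre : ¬ H.Reachable u v) :
    IsForestPacking G (Function.update F i (H ⊔ edge u v)) := by
  have hle : H ⊔ edge u v ≤ G := by
    refine sup_le (hH.trans (hF.1 i).1) ?_
    intro a b hab
    rw [edge_adj] at hab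
    rcases hab.1 with ⟨rfl, rfl⟩ | ⟨rfl, rfl⟩
    exacts [huv, huv.symm]
  have hac : (H ⊔ edge u v).IsAcyclic := ((hF.1 i).2.anti hH).sup_edge_of_not_reachable hre
  have hdis : ∀ j, j ≠ i → Disjoint (H ⊔ edge u v) (F j) := by
    intro j hj
    refine disjoint_sup_left.mpr ⟨(hF.2 i j hj.symm).mono_left hH, ?_⟩
    rw [disjoint_left]
    intro a b hab
    rw [edge_adj] at hab
    rcases hab.1 with ⟨rfl, rfl⟩ | ⟨rfl, rfl⟩
    exacts [hout j, fun h => hout j h.symm]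
  refine ⟨fun j => ?_, fun j l hjl => ?_⟩
  · by_cases hj : j = i
    · subst hj; rw [Function.update_self]; exact ⟨hle, hac⟩
    · simpa [hj] using hF.1 j
  · by_cases hj : j = i
    · subst hj
      rw [Function.update_self, Function.update_of_ne hjl.symm]
      exact hdis l hjl.symm
    · by_cases hl : l = i
      · subst hl
        rw [Function.update_self, Function.update_of_ne hj]
        exact (hdis j hj).symm
      · rw [Function.update_of_ne hj, Function.update_of_ne hl]
        exact hF.2 j l hjl

theorem ncard_edgeSet_sup_edge [Finite V] {H : SimpleGraph V} {u v : V} (hne : u ≠ v)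
    (h : ¬ H.Adj u v) : (H ⊔ edge u v).edgeSet.ncard = H.edgeSet.ncard + 1 := by
  rw [edgeSet_sup, edgeSet_edge_of_ne hne, Set.union_singleton,
    Set.ncard_insert_of_notMem (by simpa using h) (Set.toFinite _)]

theorem ncard_edgeSet_sdiff_edge [Finite V] {H : SimpleGraph V} {x y : V} (h : H.Adj x y) :
    (H \ edge x y).edgeSet.ncard + 1 = H.edgeSet.ncard := by
  rw [edgeSet_sdiff, edgeSet_edge_of_ne h.ne, Set.ncard_sdiff_singleton_add_one
    (by simpa using h) (Set.toFinite _)]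

theorem sum_ncard_edgeSet_update (F : Fin k → SimpleGraph V) (i : Fin k) (H : SimpleGraph V) :
    ∑ j, (Function.update F i H j).edgeSet.ncard + (F i).edgeSet.ncard =
      ∑ j, (F j).edgeSet.ncard + H.edgeSet.ncard := by
  rw [← Finset.add_sum_erase _ _ (Finset.mem_univ i),
    ← Finset.add_sum_erase _ (fun j => (F j).edgeSet.ncard) (Finset.mem_univ i),
    Function.update_self, Finset.sum_congr rfl (fun j hj => by
      rw [Function.update_of_ne (Finset.ne_of_mem_erase hj)])]
  omega

theorem ExchangeReachable.isForestPacking [Finite V] {G : SimpleGraph V}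
    {F F' : Fin k → SimpleGraph V}
    (h : ExchangeReachable G F F') (hF : IsForestPacking G F) :
    IsForestPacking G F' ∧ ∑ j, (F' j).edgeSet.ncard = ∑ j, (F j).edgeSet.ncard := by
  induction h with
  | refl => exact ⟨hF, rfl⟩
  | step F' i u v x y _ huv hout hxy hre ih =>
    refine ⟨ih.1.update sdiff_le huv hout hre, ?_⟩
    have h1 := sum_ncard_edgeSet_update F' i (F' i \ edge x y ⊔ edge u v)
    rw [ncard_edgeSet_sup_edge huv.ne (fun h => hout i (sdiff_le (α := SimpleGraph V) h))] at h1
    have h2 := ncard_edgeSet_sdiff_edge hxy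
    omega

variable [Finite V] {G : SimpleGraph V} {F : Fin k → SimpleGraph V}

/-- In a maximal forest packing, the ends of an uncovered edge are joined in every forest. -/
theorem ExchangeReachable.reachable_of_not_adj (hF : IsForestPacking G F)
    (hmax : ∀ F', IsForestPacking G F' →
      ∑ j : Fin k, (F' j).edgeSet.ncard ≤ ∑ j, (F j).edgeSet.ncard)
    {F' : Fin k → SimpleGraph V} (h : ExchangeReachable G F F') {u v : V} (huv : G.Adj u v)
    (hout : ∀ j, ¬ (F' j).Adj u v) (i : Fin k) : (F' i).Reachable u v := by
  by_contra hre
  obtain ⟨hF', hsum⟩ := h.isForestPacking hF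
  have h0 := hmax _ (hF'.update (le_refl (F' i)) huv hout hre)
  have h1 := sum_ncard_edgeSet_update F' i (F' i ⊔ edge u v)
  rw [ncard_edgeSet_sup_edge huv.ne (hout i)] at h1
  omega

/-- Maximality provides a path from `u` to `v` in `F' i`. Any edge of it can be exchanged for `uv`,
which leaves that edge uncovered, so the whole path lies in `uncoveredGraph G F`. -/
theorem ExchangeReachable.reachable_inf_uncoveredGraph (hF : IsForestPacking G F)
    (hmax : ∀ F', IsForestPacking G F' →
      ∑ j : Fin k, (F' j).edgeSet.ncard ≤ ∑ j, (F j).edgeSet.ncard)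
    {F' : Fin k → SimpleGraph V} (h : ExchangeReachable G F F') {u v : V} (huv : G.Adj u v)
    (hout : ∀ j, ¬ (F' j).Adj u v) (i : Fin k) :
    (F' i ⊓ uncoveredGraph G F).Reachable u v := by
  classical
  obtain ⟨hF', -⟩ := h.isForestPacking hF
  obtain ⟨p, hp⟩ := (h.reachable_of_not_adj hF hmax huv hout i).exists_isPath
  refine ⟨p.transfer _ ?_⟩
  intro e he
  induction e with | _ x y => ?_
  have hxy : (F' i).Adj x y := p.adj_of_mem_edges he
  refine ⟨hxy, (hF'.1 i).1 hxy, _, h.step F' i u v x y huv hout hxy ?_, ?_⟩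
  -- Paths in a forest are unique, so a path avoiding `xy` would coincide with `p`, which uses `xy`.
  · intro hre
    obtain ⟨q, hq⟩ := hre.exists_isPath
    have hpq' : p = q.mapLe sdiff_le := congrArg Subtype.val
      (((hF'.1 i).2.subsingleton_path u v).elim ⟨p, hp⟩ ⟨q.mapLe sdiff_le, hq.mapLe sdiff_le⟩)
    rw [hpq', Walk.edges_mapLe_eq_edges] at he
    have := q.adj_of_mem_edges he
    rw [sdiff_adj, edge_adj] at this
    exact this.2 ⟨Or.inl ⟨rfl, rfl⟩, hxy.ne⟩
  · intro j
    by_cases hj : j = i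
    · subst hj
      rw [Function.update_self, sup_adj, sdiff_adj, edge_adj, edge_adj]
      rintro (⟨_, h2⟩ | ⟨⟨rfl, rfl⟩ | ⟨rfl, rfl⟩, _⟩)
      · exact h2 ⟨Or.inl ⟨rfl, rfl⟩, hxy.ne⟩
      · exact hout _ hxy
      · exact hout _ hxy.symm
    · rw [Function.update_of_ne hj]
      exact disjoint_left.mp (hF'.2 i j (Ne.symm hj)) x y hxy

/-- Exchanges are undone one at a time: the only new edge `uv` is replaced by the path that joined
its ends in the previous forest, inside the uncovered graph. -/
theorem ExchangeReachable.reachable_inf_of_reachable_inf (hF : IsForestPacking G F)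
    (hmax : ∀ F', IsForestPacking G F' →
      ∑ j : Fin k, (F' j).edgeSet.ncard ≤ ∑ j, (F j).edgeSet.ncard)
    {F' : Fin k → SimpleGraph V} (h : ExchangeReachable G F F') {i : Fin k} {x y : V}
    (hxy : (F' i ⊓ uncoveredGraph G F).Reachable x y) :
    (F i ⊓ uncoveredGraph G F).Reachable x y := by
  induction h generalizing i x y with
  | refl => exact hxy
  | step F' l u v a b hr huv hout hab hre ih =>
    refine ih (i := i) (hxy.of_forall_adj fun w z hwz => ?_)
    by_cases hi : i = l
    · subst hi
      rw [inf_adj, Function.update_self, sup_adj, sdiff_adj, edge_adj u v] at hwz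
      obtain ⟨(⟨h1, -⟩ | ⟨⟨rfl, rfl⟩ | ⟨rfl, rfl⟩, -⟩), h2⟩ := hwz
      · exact Adj.reachable ⟨h1, h2⟩
      · exact hr.reachable_inf_uncoveredGraph hF hmax huv hout i
      · exact (hr.reachable_inf_uncoveredGraph hF hmax huv hout i).symm
    · rw [Function.update_of_ne hi] at hwz
      exact hwz.reachable

theorem reachable_inf_uncoveredGraph (hF : IsForestPacking G F)
    (hmax : ∀ F', IsForestPacking G F' →
      ∑ j : Fin k, (F' j).edgeSet.ncard ≤ ∑ j, (F j).edgeSet.ncard) (i : Fin k) {x y : V}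
    (hxy : (uncoveredGraph G F).Reachable x y) :
    (F i ⊓ uncoveredGraph G F).Reachable x y := by
  refine hxy.of_forall_adj fun u v huv => ?_
  obtain ⟨hG, F', hF', hout⟩ := huv
  exact hF'.reachable_inf_of_reachable_inf hF hmax
    (hF'.reachable_inf_uncoveredGraph hF hmax hG hout i)

end Packing

/-- The **Nash-Williams–Tutte theorem** (sufficiency): a finite graph in which every partition of
the vertex set into `p` parts has at least `k (p - 1)` crossing edges contains `k` pairwise
edge-disjoint spanning trees. -/
theorem exists_isSpanningTreePacking {V : Type*} [Finite V] [Nonempty V] (G : SimpleGraph V)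
    (k : ℕ)
    (h : ∀ s : Setoid V, k * Nat.card (Quotient s) ≤
      (G.crossGraph (Quotient.mk s)).edgeSet.ncard + k) :
    ∃ F : Fin k → SimpleGraph V, IsSpanningTreePacking G F := by
  classical
  obtain ⟨F, hF, hmax⟩ := Set.exists_max_image {F : Fin k → SimpleGraph V | IsForestPacking G F}
    (fun F => ∑ j, (F j).edgeSet.ncard) (Set.toFinite _)
    ⟨fun _ => ⊥, fun _ => ⟨bot_le, isAcyclic_bot⟩, fun _ _ _ => disjoint_bot_left⟩
  -- The critical partition is into the components of `U`. Each `F i` restricted to `U` already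
  -- spans these components, so few of its edges are left to cross between them.
  set U := uncoveredGraph G F with hU
  set X := G.crossGraph (Quotient.mk U.reachableSetoid) with hX
  have hcomp : ∀ i, Nat.card (F i ⊓ U).ConnectedComponent ≤ Nat.card U.ConnectedComponent := by
    intro i
    refine Nat.card_le_card_of_injective
      (ConnectedComponent.map (Hom.ofLE (inf_le_right : F i ⊓ U ≤ U))) ?_
    intro c c' hcc
    obtain ⟨x, rfl⟩ := Quot.exists_rep c
    obtain ⟨y, rfl⟩ := Quot.exists_rep c'
    exact ConnectedComponent.sound
      (reachable_inf_uncoveredGraph hF hmax i (ConnectedComponent.exact hcc))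
  have hcross : ∀ i, (F i ⊓ X).edgeSet.ncard + Nat.card (F i).ConnectedComponent ≤
      Nat.card U.ConnectedComponent := by
    intro i
    have h1 := (hF.1 i).2.ncard_edgeSet_add_card_connectedComponent_le
    have h2 := (F i ⊓ U).card_le_ncard_edgeSet_add_card_connectedComponent
    have h3 : (F i ⊓ X).edgeSet.ncard + (F i ⊓ U).edgeSet.ncard ≤ (F i).edgeSet.ncard := by
      rw [← Set.ncard_union_eq _ (Set.toFinite _) (Set.toFinite _)]
      · exact Set.ncard_le_ncard (Set.union_subset (edgeSet_mono inf_le_left)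
          (edgeSet_mono inf_le_left)) (Set.toFinite _)
      · rw [disjoint_edgeSet, disjoint_left]
        intro a b hab hab'
        exact (crossGraph_adj.mp hab.2).2 (Quotient.sound hab'.2.reachable)
    have := hcomp i
    omega
  have hcover : X.edgeSet.ncard ≤ ∑ i, (F i ⊓ X).edgeSet.ncard := by
    calc X.edgeSet.ncard ≤ (⋃ i, (F i ⊓ X).edgeSet).ncard := by
          refine Set.ncard_le_ncard ?_ (Set.toFinite _)
          intro e he
          induction e with | _ a b => ?_
          by_contra hne
          simp only [Set.mem_iUnion, not_exists, mem_edgeSet, inf_adj, not_and] at hne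
          have hab := crossGraph_adj.mp he
          refine hab.2 (Quotient.sound (Adj.reachable ?_))
          -- An edge missed by `F` itself lies in `U`, hence does not cross; so the forests cover
          -- all crossing edges.
          exact ⟨hab.1, F, .refl, fun j hj => hne j hj he⟩
      _ ≤ _ := Set.ncard_iUnion_le_of_fintype _
  have hpos : ∀ i, 1 ≤ Nat.card (F i).ConnectedComponent := fun i => Nat.card_pos
  have hsum : ∑ i, Nat.card (F i).ConnectedComponent ≤ ∑ _i : Fin k, 1 := by
    have h1 := Finset.sum_le_sum (fun i (_ : i ∈ Finset.univ) => hcross i)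
    rw [Finset.sum_add_distrib] at h1
    have h2 : k * Nat.card U.ConnectedComponent ≤ X.edgeSet.ncard + k := h U.reachableSetoid
    simp only [Finset.sum_const, Finset.card_univ, Fintype.card_fin, smul_eq_mul] at h1 ⊢
    omega
  refine ⟨F, fun i => ⟨(hF.1 i).1, ?_, (hF.1 i).2⟩, fun i j hij =>
    disjoint_edgeSet.mpr (hF.2 i j hij)⟩
  have hone : Nat.card (F i).ConnectedComponent = 1 := by
    by_contra hne
    exact absurd hsum (not_le.mpr (Finset.sum_lt_sum (fun j _ => hpos j)
      ⟨i, Finset.mem_univ i, by have := hpos i; omega⟩))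
  have := (Nat.card_eq_one_iff_unique.mp hone).1
  have hpre : (F i).Preconnected := fun x y =>
    ConnectedComponent.exact (Subsingleton.elim _ _)
  exact ⟨hpre⟩

end SimpleGraph

namespace SimpleGraph

/-! ### Distance levels below half the girth. -/

section Levels

variable {V : Type*} {H : SimpleGraph V}

/-- Two distinct paths with the same ends contain a cycle. -/
theorem egirth_le_of_isPath_ne {x v : V} {p q : H.Walk x v} (hp : p.IsPath) (hq : q.IsPath)
    (hne : p ≠ q) : H.egirth ≤ (p.length + q.length : ℕ) := by
  classical
  -- In the union of the two paths a cycle exists, since forests have unique paths, and its edges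
  -- are among those of `p` and `q`.
  set K : SimpleGraph V := fromEdgeSet {e | e ∈ p.edges ++ q.edges} with hK
  have hmem : ∀ e ∈ p.edges ++ q.edges, e ∈ H.edgeSet := by
    intro e he
    rcases List.mem_append.mp he with he | he
    exacts [p.edges_subset_edgeSet he, q.edges_subset_edgeSet he]
  have hKe : ∀ e ∈ p.edges ++ q.edges, e ∈ K.edgeSet := by
    intro e he
    rw [hK, edgeSet_fromEdgeSet]
    exact ⟨he, fun hd => H.not_isDiag_of_mem_edgeSet (hmem e he) hd⟩
  have hKH : K ≤ H := by
    intro a b hab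
    rw [hK, fromEdgeSet_adj] at hab
    exact hmem _ hab.1
  have hpK : ∀ e ∈ p.edges, e ∈ K.edgeSet := fun e he => hKe e (List.mem_append_left _ he)
  have hqK : ∀ e ∈ q.edges, e ∈ K.edgeSet := fun e he => hKe e (List.mem_append_right _ he)
  have hcyc : ¬ K.IsAcyclic := by
    intro hac
    have h := congrArg Subtype.val ((hac.subsingleton_path x v).elim
      ⟨p.transfer K hpK, hp.transfer hpK⟩ ⟨q.transfer K hqK, hq.transfer hqK⟩)
    refine hne (Walk.ext_support ?_)
    have h' := congrArg Walk.support (h : p.transfer K hpK = q.transfer K hqK)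
    simpa using h'
  simp only [IsAcyclic, not_forall, not_not] at hcyc
  obtain ⟨a, c, hc⟩ := hcyc
  refine (egirth_anti hKH).trans ((egirth_le_length hc).trans ?_)
  have hsub : c.edges.toFinset ⊆ (p.edges ++ q.edges).toFinset := by
    intro e he
    have := c.edges_subset_edgeSet (List.mem_toFinset.mp he)
    rw [hK, edgeSet_fromEdgeSet] at this
    exact List.mem_toFinset.mpr this.1
  have h1 := Finset.card_le_card hsub
  rw [List.toFinset_card_of_nodup hc.isCircuit.isTrail.edges_nodup, Walk.length_edges] at h1
  have h2 := List.toFinset_card_le (p.edges ++ q.edges)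
  rw [List.length_append, Walk.length_edges, Walk.length_edges] at h2
  exact_mod_cast h1.trans h2

/-- Below half the girth, a vertex has at most one neighbour that is not further from the root. -/
theorem eq_of_adj_of_edist_le {x v w w' : V} {i : ℕ} (hgirth : ((2 * (i + 1) : ℕ) : ℕ∞) < H.egirth)
    (hw : H.Adj w v) (hw' : H.Adj w' v) (hi : H.edist x w ≤ i) (hi' : H.edist x w' ≤ i)
    (hv : H.edist x w ≤ H.edist x v) (hv' : H.edist x w' ≤ H.edist x v) : w = w' := by
  classical
  -- A shortest path to `w` avoids `v`, which is no nearer to `x`, so it extends to `v`. Two choices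
  -- of `w` would give a cycle of length at most `2 (i + 1)`.
  have key : ∀ w : V, H.Adj w v → H.edist x w ≤ i → H.edist x w ≤ H.edist x v →
      ∃ p : H.Walk x v, p.IsPath ∧ p.length ≤ i + 1 ∧ p.penultimate = w := by
    intro w hw hi hv
    have hr : H.Reachable x w := reachable_of_edist_ne_top (fun h => by simp [h] at hi)
    obtain ⟨p, hp, hlen⟩ := hr.exists_path_of_dist
    have hd : (p.length : ℕ∞) = H.edist x w := by rw [hlen, hr.coe_dist_eq_edist]
    have hvp : v ∉ p.support := by
      intro hmem
      have h1 : H.edist x v ≤ (p.takeUntil v hmem).length := edist_le _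
      have h2 := p.length_takeUntil_lt_length hmem hw.ne'
      have h3 : (p.length : ℕ∞) ≤ (p.takeUntil v hmem).length := hd.le.trans (hv.trans h1)
      exact absurd (by exact_mod_cast h3) (not_le.mpr h2)
    refine ⟨p.concat hw, hp.concat hvp hw, ?_, Walk.penultimate_concat p hw⟩
    have : p.length ≤ i := by rw [← hd] at hi; exact_mod_cast hi
    rw [Walk.length_concat]; omega
  obtain ⟨p, hp, hlen, hpw⟩ := key w hw hi hv
  obtain ⟨q, hq, hlen', hqw⟩ := key w' hw' hi' hv'
  by_contra hne
  have hpq : p ≠ q := fun h => hne (by rw [← hpw, ← hqw, h])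
  have h1 := hgirth.trans_le (egirth_le_of_isPath_ne hp hq hpq)
  have h2 : 2 * (i + 1) < p.length + q.length := by exact_mod_cast h1
  omega

variable [Fintype V]

open Classical in
/-- The set of vertices at distance exactly `i` from `x`. -/
noncomputable def distLevel (H : SimpleGraph V) (x : V) (i : ℕ) : Finset V :=
  {v | H.edist x v = i}

theorem mem_distLevel {x v : V} {i : ℕ} : v ∈ H.distLevel x i ↔ H.edist x v = i := by
  simp [distLevel]

theorem distLevel_zero (x : V) : H.distLevel x 0 = {x} := by
  ext v; simp [mem_distLevel, eq_comm (a := v)]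

theorem disjoint_distLevel (x : V) {i j : ℕ} (hij : i ≠ j) :
    Disjoint (H.distLevel x i) (H.distLevel x j) := by
  rw [Finset.disjoint_left]
  intro v hv hv'
  rw [mem_distLevel] at hv hv'
  exact hij (by exact_mod_cast hv.symm.trans hv')

theorem card_distLevel_one [DecidableRel H.Adj] (x : V) :
    (H.distLevel x 1).card = H.degree x := by
  rw [← card_neighborFinset_eq_degree]
  congr 1
  ext v; simp [mem_distLevel]

/-- Below half the girth, the levels of a graph grow like those of a tree. -/
theorem sum_degree_distLevel_le [DecidableRel H.Adj] (x : V) {i : ℕ}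
    (hgirth : ((2 * (i + 1) : ℕ) : ℕ∞) < H.egirth) :
    ∑ v ∈ H.distLevel x i, H.degree v ≤
      (H.distLevel x (i + 1)).card + (H.distLevel x i).card := by
  classical
  have h1 : ∀ v ∈ H.distLevel x i, H.degree v ≤
      ((H.distLevel x (i + 1)).bipartiteAbove H.Adj v).card + 1 := by
    intro v hv
    rw [mem_distLevel] at hv
    have hsub : H.neighborFinset v ⊆ (H.distLevel x (i + 1)).bipartiteAbove H.Adj v ∪
        {w ∈ H.neighborFinset v | H.edist x w ≤ i} := by
      intro w hw
      rw [mem_neighborFinset] at hw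
      by_cases hwi : H.edist x w ≤ i
      · exact Finset.mem_union_right _ (by simp [hw, hwi])
      · refine Finset.mem_union_left _ ?_
        rw [Finset.mem_bipartiteAbove, mem_distLevel]
        refine ⟨le_antisymm ?_ ?_, hw⟩
        · calc H.edist x w ≤ H.edist x v + H.edist v w := H.edist_triangle
            _ = _ := by rw [hv, edist_eq_one_iff_adj.mpr hw]; simp
        · rw [not_le] at hwi
          have := Order.add_one_le_of_lt hwi
          exact_mod_cast this
    have hone : ({w ∈ H.neighborFinset v | H.edist x w ≤ i} : Finset V).card ≤ 1 := by
      refine Finset.card_le_one.mpr fun w hw w' hw' => ?_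
      rw [Finset.mem_filter, mem_neighborFinset] at hw hw'
      exact eq_of_adj_of_edist_le hgirth hw.1.symm hw'.1.symm hw.2 hw'.2
        (hv ▸ hw.2) (hv ▸ hw'.2)
    calc H.degree v = (H.neighborFinset v).card := (card_neighborFinset_eq_degree H v).symm
      _ ≤ _ := Finset.card_le_card hsub
      _ ≤ _ := Finset.card_union_le _ _
      _ ≤ _ := by omega
  have h2 : ∀ w ∈ H.distLevel x (i + 1),
      ((H.distLevel x i).bipartiteBelow H.Adj w).card ≤ 1 := by
    intro w hw
    rw [mem_distLevel] at hw
    refine Finset.card_le_one.mpr fun v hv v' hv' => ?_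
    rw [Finset.mem_bipartiteBelow, mem_distLevel] at hv hv'
    have hle : (i : ℕ∞) ≤ H.edist x w := by rw [hw]; exact_mod_cast Nat.le_succ i
    exact eq_of_adj_of_edist_le hgirth hv.2 hv'.2 hv.1.le hv'.1.le (hv.1 ▸ hle) (hv'.1 ▸ hle)
  calc ∑ v ∈ H.distLevel x i, H.degree v
      ≤ ∑ v ∈ H.distLevel x i, (((H.distLevel x (i + 1)).bipartiteAbove H.Adj v).card + 1) :=
        Finset.sum_le_sum h1
    _ = ∑ w ∈ H.distLevel x (i + 1), ((H.distLevel x i).bipartiteBelow H.Adj w).card +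
          (H.distLevel x i).card := by
        rw [Finset.sum_add_distrib, Finset.sum_card_bipartiteAbove_eq_sum_card_bipartiteBelow]
        simp
    _ ≤ _ := by
        gcongr
        simpa using Finset.sum_le_sum h2

/-- Here `b v` allows for the edges lost at `v` on passing to a subgraph: every lost edge costs at
most one vertex of the next level. -/
theorem mul_card_distLevel_le [DecidableRel H.Adj] (x : V) {i d : ℕ} {b : V → ℕ}
    (hgirth : ((2 * (i + 1) : ℕ) : ℕ∞) < H.egirth)
    (hb : ∀ v ∈ H.distLevel x i, d + 1 ≤ H.degree v + b v) :
    d * (H.distLevel x i).card ≤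
      (H.distLevel x (i + 1)).card + ∑ v ∈ H.distLevel x i, b v := by
  have h1 := sum_degree_distLevel_le x hgirth
  have h2 := Finset.sum_le_sum hb
  rw [Finset.sum_const, smul_eq_mul, mul_add, mul_one,
    Finset.sum_add_distrib, mul_comm] at h2
  omega

end Levels

end SimpleGraph

/-! ### Geometric growth with losses, compared with `nOneStar`. -/

/-- A sequence growing geometrically up to a bounded total loss. -/
theorem mul_pow_le_add_pow_of_growth {M β : ℕ → ℕ} {c d t : ℕ} (hd : 1 ≤ d) (hM : c ≤ M 1)
    (hgrow : ∀ i, 1 ≤ i → i < t → d * M i ≤ M (i + 1) + β i)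
    (hβ : ∑ i ∈ Finset.Ico 1 t, β i ≤ d) {j : ℕ} (hj : 1 ≤ j) (hjt : j < t) :
    c * d ^ j ≤ M (j + 1) + d ^ j := by
  -- A loss at level `i` is multiplied by `d` at each later level. The weight `d ^ (j - 1)` is that
  -- of the worst case, a loss at level 1.
  have key : ∀ j, 1 ≤ j → j < t →
      c * d ^ j ≤ M (j + 1) + d ^ (j - 1) * ∑ i ∈ Finset.Ico 1 (j + 1), β i := by
    intro j hj
    induction j, hj using Nat.le_induction with
    | base =>
      intro ht
      have := hgrow 1 le_rfl ht
      simp only [pow_one, Nat.reduceAdd, tsub_self, pow_zero, one_mul]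
      have h1 : Finset.Ico 1 2 = {1} := rfl
      rw [h1, Finset.sum_singleton]
      nlinarith
    | succ j hj ih =>
      intro ht
      have h1 := ih (by omega)
      have h2 := hgrow (j + 1) (by omega) ht
      rw [Finset.sum_Ico_succ_top (by omega)]
      obtain ⟨m, rfl⟩ : ∃ m, j = m + 1 := ⟨j - 1, by omega⟩
      simp only [Nat.add_sub_cancel] at h1 ⊢
      have h3 : β (m + 1 + 1) ≤ d ^ (m + 1) * β (m + 1 + 1) :=
        Nat.le_mul_of_pos_left _ (Nat.pow_pos hd)
      have h4 := Nat.mul_le_mul_left d h1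
      calc c * d ^ (m + 1 + 1) = d * (c * d ^ (m + 1)) := by ring
        _ ≤ d * (M (m + 1 + 1) + d ^ m * ∑ i ∈ Finset.Ico 1 (m + 1 + 1), β i) := h4
        _ = d * M (m + 1 + 1) + d ^ (m + 1) * ∑ i ∈ Finset.Ico 1 (m + 1 + 1), β i := by ring
        _ ≤ _ := by rw [mul_add]; omega
  have h1 := key j hj hjt
  have h2 : ∑ i ∈ Finset.Ico 1 (j + 1), β i ≤ d :=
    (Finset.sum_le_sum_of_subset (Finset.Ico_subset_Ico_right (by omega))).trans hβ
  have h3 : d ^ (j - 1) * ∑ i ∈ Finset.Ico 1 (j + 1), β i ≤ d ^ j := by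
    obtain ⟨m, rfl⟩ : ∃ m, j = m + 1 := ⟨j - 1, by omega⟩
    rw [pow_succ]
    exact Nat.mul_le_mul_left _ h2
  omega

/-- Growth from a vertex: `c = d + 1` leaves at least `(d + 1) d ^ j - d ^ j = d ^ (j + 1)` at level
`j + 1`. -/
theorem nOneStar_odd_le_sum {M β : ℕ → ℕ} {d t : ℕ} (ht : 1 ≤ t) (hd : 1 ≤ d) (hM₀ : 1 ≤ M 0)
    (hM : d + 1 ≤ M 1) (hgrow : ∀ i, 1 ≤ i → i < t → d * M i ≤ M (i + 1) + β i)
    (hβ : ∑ i ∈ Finset.Ico 1 t, β i ≤ d) :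
    nOneStar (d + 1) (2 * t + 1) ≤ ∑ i ∈ Finset.range (t + 1), (M i : ℝ) := by
  have hstar : nOneStar (d + 1) (2 * t + 1) =
      ((1 + (d + 1) + ∑ i ∈ Finset.Icc 2 t, d ^ i : ℕ) : ℝ) := by
    simp [nOneStar]
  rw [hstar, ← Nat.cast_sum, Nat.cast_le]
  have key : ∀ s, 1 ≤ s → s ≤ t →
      1 + (d + 1) + ∑ i ∈ Finset.Icc 2 s, d ^ i ≤ ∑ i ∈ Finset.range (s + 1), M i := by
    intro s hs
    induction s, hs using Nat.le_induction with
    | base => intro _; simp [Finset.sum_range_succ]; omega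
    | succ s hs ih =>
      intro hst
      have h1 := ih (by omega)
      have h2 := mul_pow_le_add_pow_of_growth hd hM hgrow hβ hs (by omega)
      rw [Finset.sum_range_succ, Finset.sum_Icc_succ_top (by omega)]
      have h3 : (d + 1) * d ^ s = d ^ (s + 1) + d ^ s := by ring
      omega
  exact key t ht le_rfl

/-- Growth from an edge: `c = 2 * d` leaves at least `2 d ^ (j + 1) - d ^ j` at level `j + 1`, and
the sum of these telescopes to the closed form. -/
theorem nOneStar_even_le_sum {M β : ℕ → ℕ} {d t : ℕ} (ht : 1 ≤ t) (hd : 1 ≤ d) (hM₀ : 2 ≤ M 0)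
    (hM : 2 * d ≤ M 1) (hgrow : ∀ i, 1 ≤ i → i < t → d * M i ≤ M (i + 1) + β i)
    (hβ : ∑ i ∈ Finset.Ico 1 t, β i ≤ d) :
    nOneStar (d + 1) (2 * t + 2) ≤ ∑ i ∈ Finset.range (t + 1), (M i : ℝ) := by
  have hstar : nOneStar (d + 1) (2 * t + 2) =
      ((2 + 2 * d ^ t + ∑ i ∈ Finset.Icc 1 (t - 1), d ^ i : ℕ) : ℝ) := by
    have h : (2 * t + 1) / 2 = t := by omega
    simp [nOneStar, h]
  rw [hstar, ← Nat.cast_sum, Nat.cast_le]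
  have key : ∀ s, 1 ≤ s → s ≤ t →
      2 + 2 * d ^ s + ∑ i ∈ Finset.Icc 1 (s - 1), d ^ i ≤ ∑ i ∈ Finset.range (s + 1), M i := by
    intro s hs
    induction s, hs using Nat.le_induction with
    | base => intro _; simp [Finset.sum_range_succ]; omega
    | succ s hs ih =>
      intro hst
      have h1 := ih (by omega)
      have h2 := mul_pow_le_add_pow_of_growth hd hM hgrow hβ hs (by omega)
      rw [Finset.sum_range_succ]
      obtain ⟨m, rfl⟩ : ∃ m, s = m + 1 := ⟨s - 1, by omega⟩
      rw [show m + 1 + 1 - 1 = m + 1 from rfl, Finset.sum_Icc_succ_top (by omega)]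
      rw [show m + 1 - 1 = m from rfl] at h1
      have h3 : 2 * d * d ^ (m + 1) = 2 * d ^ (m + 1 + 1) := by ring
      omega
  exact key t ht le_rfl

namespace SimpleGraph

/-! ### Vertex sets left by few edges are large. -/

section Inside

variable {V : Type*} {G H : SimpleGraph V}

/-- The subgraph of `G` formed by the edges with both ends in `S`. -/
def insideGraph (G : SimpleGraph V) (S : Finset V) : SimpleGraph V where
  Adj u v := G.Adj u v ∧ u ∈ S ∧ v ∈ S
  symm := ⟨fun _ _ h => ⟨h.1.symm, h.2.2, h.2.1⟩⟩
  loopless := ⟨fun _ h => h.1.ne rfl⟩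

instance [DecidableEq V] [DecidableRel G.Adj] (S : Finset V) : DecidableRel (G.insideGraph S).Adj :=
  fun u v => inferInstanceAs (Decidable (G.Adj u v ∧ u ∈ S ∧ v ∈ S))

theorem insideGraph_adj {S : Finset V} {u v : V} :
    (G.insideGraph S).Adj u v ↔ G.Adj u v ∧ u ∈ S ∧ v ∈ S := Iff.rfl

theorem insideGraph_le (S : Finset V) : G.insideGraph S ≤ G := fun _ _ h => h.1

theorem mem_of_reachable_of_le_insideGraph {S : Finset V} (hH : H ≤ G.insideGraph S) {x v : V}
    (hx : x ∈ S) (h : H.Reachable x v) : v ∈ S := by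
  obtain ⟨p⟩ := h.symm
  cases p with
  | nil => exact hx
  | cons hadj _ => exact (hH hadj).2.1

theorem sum_card_le_of_pairwiseDisjoint [DecidableEq V] {S : Finset V} {L : ℕ → Finset V} {t : ℕ}
    (hL : ∀ i, L i ⊆ S) (hdis : ∀ i j, i ≤ t → j ≤ t → i ≠ j → Disjoint (L i) (L j)) :
    ∑ i ∈ Finset.range (t + 1), (L i).card ≤ S.card := by
  rw [← Finset.card_biUnion fun i hi j hj hij => hdis i j
    (by simpa [Nat.lt_succ_iff] using hi) (by simpa [Nat.lt_succ_iff] using hj) hij]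
  exact Finset.card_le_card (Finset.biUnion_subset.mpr fun i _ => hL i)

theorem sum_sum_le_of_pairwiseDisjoint [DecidableEq V] {S : Finset V} {L : ℕ → Finset V} {t : ℕ} (b : V → ℕ)
    (hL : ∀ i, L i ⊆ S) (hdis : ∀ i j, i ≤ t → j ≤ t → i ≠ j → Disjoint (L i) (L j)) :
    ∑ i ∈ Finset.Ico 1 t, ∑ v ∈ L i, b v ≤ ∑ v ∈ S, b v := by
  rw [← Finset.sum_biUnion fun i hi j hj hij => hdis i j
    (Finset.mem_Ico.mp hi).2.le (Finset.mem_Ico.mp hj).2.le hij]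
  exact Finset.sum_le_sum_of_subset (Finset.biUnion_subset.mpr fun i _ => hL i)

theorem distLevel_subset_of_le_insideGraph [Fintype V] {S : Finset V} (hH : H ≤ G.insideGraph S) {x : V}
    (hx : x ∈ S) (i : ℕ) : H.distLevel x i ⊆ S := by
  intro v hv
  rw [mem_distLevel] at hv
  exact mem_of_reachable_of_le_insideGraph hH hx
    (reachable_of_edist_ne_top (by rw [hv]; exact ENat.natCast_ne_top i))

variable [Fintype V] [DecidableEq V]

/-- The number of neighbours of `v` outside `S`. -/
def outDegree (G : SimpleGraph V) [DecidableRel G.Adj] (S : Finset V) (v : V) : ℕ :=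
  ((G.neighborFinset v).filter (· ∉ S)).card

theorem degree_insideGraph_add_outDegree [DecidableRel G.Adj] {S : Finset V} {v : V}
    (hv : v ∈ S) : (G.insideGraph S).degree v + G.outDegree S v = G.degree v := by
  rw [outDegree, ← card_neighborFinset_eq_degree, ← card_neighborFinset_eq_degree,
    ← Finset.card_filter_add_card_filter_not (s := G.neighborFinset v) (· ∈ S)]
  congr 2
  ext w
  simp [insideGraph_adj, hv]

theorem degree_sdiff_edge_add_one [DecidableRel H.Adj] {x y : V}
    (hxy : H.Adj x y) : (H \ edge x y).degree x + 1 = H.degree x := by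
  rw [← card_neighborFinset_eq_degree, ← card_neighborFinset_eq_degree,
    ← Finset.card_erase_add_one ((H.mem_neighborFinset x y).mpr hxy)]
  congr 2
  ext w
  simp only [mem_neighborFinset, sdiff_adj, edge_adj, Finset.mem_erase]
  have := hxy.ne
  grind [SimpleGraph.Adj.ne]

theorem degree_sdiff_edge_of_ne [DecidableRel H.Adj] {x y v : V}
    (hx : v ≠ x) (hy : v ≠ y) : (H \ edge x y).degree v = H.degree v := by
  rw [← card_neighborFinset_eq_degree, ← card_neighborFinset_eq_degree]
  congr 1
  ext w
  simp [edge_adj, hx, hy]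

/-- If the edge `xy` lies on no short cycle, the vertices close to `x` and those close to `y` are
different once the edge is deleted. -/
theorem disjoint_distLevel_sdiff_edge {x y : V} (hxy : H.Adj x y) {t i j : ℕ}
    (hgirth : ((2 * t + 1 : ℕ) : ℕ∞) < H.egirth) (hi : i ≤ t) (hj : j ≤ t) :
    Disjoint ((H \ edge x y).distLevel x i) ((H \ edge x y).distLevel y j) := by
  rw [Finset.disjoint_left]
  intro v hv hv'
  rw [mem_distLevel] at hv hv'
  obtain ⟨p, hp⟩ := exists_walk_of_edist_eq_coe hv
  obtain ⟨q, hq⟩ := exists_walk_of_edist_eq_coe hv'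
  set r := (p.append q.reverse).bypass with hr
  have hrl : r.length ≤ 2 * t := by
    have h1 := (p.append q.reverse).length_bypass_le_length
    rw [← hr, Walk.length_append, Walk.length_reverse] at h1
    omega
  have hrp : r.IsPath := Walk.bypass_isPath _
  -- The path `r` avoids the edge `xy`, so together they would close a cycle of length at most `2 *
  -- t + 1`.
  have hne : r.mapLe (sdiff_le : H \ edge x y ≤ H) ≠ hxy.toWalk := by
    intro h
    have h1 := congrArg Walk.edges h
    rw [Walk.edges_mapLe_eq_edges] at h1
    have h2 : s(x, y) ∈ r.edges := by rw [h1]; simp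
    have h3 := r.adj_of_mem_edges h2
    rw [sdiff_adj, edge_adj] at h3
    exact h3.2 ⟨Or.inl ⟨rfl, rfl⟩, hxy.ne⟩
  have h1 := hgirth.trans_le
    (egirth_le_of_isPath_ne (hrp.mapLe sdiff_le) (Walk.IsPath.of_adj hxy) hne)
  rw [Nat.cast_lt, Walk.length_map, Adj.length_toWalk] at h1
  omega

end Inside

section Size

variable {V : Type*} [Fintype V] [DecidableEq V] {G : SimpleGraph V} [DecidableRel G.Adj]

/-- If `S` had `s ≤ d` vertices, each would send at least `d + 2 - s` edges outside, and `s (d + 2 -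
s) > d` for `1 ≤ s ≤ d`. -/
theorem card_lt_of_sum_outDegree_le {S : Finset V} {d : ℕ} (hS : S.Nonempty)
    (hdeg : ∀ v ∈ S, d + 1 ≤ G.degree v) (hb : ∑ v ∈ S, G.outDegree S v ≤ d) : d < S.card := by
  by_contra! hle
  have h1 : ∀ v ∈ S, d + 2 ≤ S.card + G.outDegree S v := by
    intro v hv
    have h2 := degree_insideGraph_add_outDegree (G := G) hv
    have h3 := hdeg v hv
    have h4 : (G.insideGraph S).degree v + 1 ≤ S.card := by
      rw [← card_neighborFinset_eq_degree, ← Finset.card_erase_add_one hv]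
      refine Nat.add_le_add_right (Finset.card_le_card fun w hw => ?_) 1
      rw [mem_neighborFinset] at hw
      exact Finset.mem_erase.mpr ⟨hw.ne', hw.2.2⟩
    omega
  have h2 := Finset.sum_le_sum h1
  rw [Finset.sum_const, Finset.sum_add_distrib, Finset.sum_const, smul_eq_mul, smul_eq_mul] at h2
  have h3 : 1 ≤ S.card := hS.card_pos
  obtain ⟨m, hm⟩ := Nat.exists_eq_add_of_le hle
  obtain ⟨n, hn⟩ := Nat.exists_eq_add_of_le h3
  rw [hn] at h2 hm
  nlinarith [Nat.zero_le (n * m)]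

/-- Supplies roots for the level count that keep their full degree inside `S`. -/
theorem exists_outDegree_eq_zero {S T : Finset V} {d : ℕ} (hT : T ⊆ S)
    (hb : ∑ v ∈ S, G.outDegree S v ≤ d) (hd : d < T.card) : ∃ x ∈ T, G.outDegree S x = 0 := by
  by_contra! h
  have h1 : ∑ v ∈ T, 1 ≤ ∑ v ∈ T, G.outDegree S v :=
    Finset.sum_le_sum fun v hv => Nat.one_le_iff_ne_zero.mpr (h v hv)
  have h2 : ∑ v ∈ T, G.outDegree S v ≤ ∑ v ∈ S, G.outDegree S v := Finset.sum_le_sum_of_subset hT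
  simp only [Finset.sum_const, smul_eq_mul, mul_one] at h1
  omega

/-- In a graph of girth at least `g` and minimum degree at least `δ`, a nonempty vertex set left by
fewer than `δ` edges has at least `nOneStar δ g` elements. -/
theorem nOneStar_le_card {S : Finset V} {g δ : ℕ} (hg : 3 ≤ g) (hgirth : (g : ℕ∞) ≤ G.egirth)
    (hS : S.Nonempty) (hδ : 2 ≤ δ) (hdeg : ∀ v ∈ S, δ ≤ G.degree v)
    (hb : ∑ v ∈ S, G.outDegree S v < δ) : nOneStar δ g ≤ S.card := by
  obtain ⟨d, rfl⟩ : ∃ d, δ = d + 1 := ⟨δ - 1, by omega⟩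
  have hb' : ∑ v ∈ S, G.outDegree S v ≤ d := by omega
  obtain ⟨x, hxS, hx⟩ := exists_outDegree_eq_zero subset_rfl hb'
    (card_lt_of_sum_outDegree_le hS hdeg hb')
  set H := G.insideGraph S with hH
  have hHdeg : ∀ v ∈ S, d + 1 ≤ H.degree v + G.outDegree S v := fun v hv =>
    (hdeg v hv).trans_eq (degree_insideGraph_add_outDegree hv).symm
  have hHx : d + 1 ≤ H.degree x := by simpa [hx] using hHdeg x hxS
  have hHgirth : (g : ℕ∞) ≤ H.egirth := hgirth.trans (egirth_anti (insideGraph_le S))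
  obtain ⟨t, ht⟩ | ⟨t, ht⟩ : (∃ t, g = 2 * t + 1) ∨ ∃ t, g = 2 * t + 2 := by
    rcases Nat.even_or_odd' (g - 1) with ⟨t, ht | ht⟩
    · exact Or.inl ⟨t, by omega⟩
    · exact Or.inr ⟨t, by omega⟩
  · subst ht
    have hsub := distLevel_subset_of_le_insideGraph (le_refl H) hxS
    have hdis : ∀ i j, i ≤ t → j ≤ t → i ≠ j → Disjoint (H.distLevel x i) (H.distLevel x j) :=
      fun i j _ _ hij => disjoint_distLevel x hij
    have h1 := nOneStar_odd_le_sum (t := t) (d := d) (M := fun i => (H.distLevel x i).card)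
      (β := fun i => ∑ v ∈ H.distLevel x i, G.outDegree S v) (by omega) (by omega)
      (by simp [distLevel_zero]) (by simpa [card_distLevel_one] using hHx)
      (fun i _ hit => mul_card_distLevel_le x
        (lt_of_lt_of_le (by exact_mod_cast (by omega : 2 * (i + 1) < 2 * t + 1)) hHgirth)
        fun v hv => hHdeg v (hsub i hv))
      ((sum_sum_le_of_pairwiseDisjoint _ hsub hdis).trans hb')
    have h2 := sum_card_le_of_pairwiseDisjoint hsub hdis
    exact h1.trans (by exact_mod_cast h2)
  · subst ht
    -- For even girth the levels grow from both ends of an edge `xy`. Since `x` has more than `d`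
    -- neighbours in `S`, one of them also has no edge leaving `S`.
    have hNS : H.neighborFinset x ⊆ S := fun w hw => ((H.mem_neighborFinset x w).mp hw).2.2
    obtain ⟨y, hyN, hy⟩ := exists_outDegree_eq_zero hNS hb'
      (by rw [card_neighborFinset_eq_degree]; omega)
    have hyS := hNS hyN
    have hxy : H.Adj x y := (H.mem_neighborFinset x y).mp hyN
    have hHy : d + 1 ≤ H.degree y := by simpa [hy] using hHdeg y hyS
    set K := H \ edge x y with hK
    have hKH : K ≤ H := sdiff_le
    have hKgirth : ((2 * t + 2 : ℕ) : ℕ∞) ≤ K.egirth := hHgirth.trans (egirth_anti hKH)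
    have hKx : d ≤ K.degree x := by
      have h1 : K.degree x + 1 = H.degree x := degree_sdiff_edge_add_one hxy
      omega
    have hKy : d ≤ K.degree y := by
      have h1 := degree_sdiff_edge_add_one hxy.symm
      have h2 : (H \ edge y x).degree y = K.degree y := by
        rw [← card_neighborFinset_eq_degree, ← card_neighborFinset_eq_degree]
        congr 1
        ext w
        simp [hK, edge_comm y x]
      omega
    have hxy_dis : ∀ i j, i ≤ t → j ≤ t → Disjoint (K.distLevel x i) (K.distLevel y j) :=
      fun i j hi hj => disjoint_distLevel_sdiff_edge hxy
        (lt_of_lt_of_le (by exact_mod_cast (by omega : 2 * t + 1 < 2 * t + 2)) hHgirth) hi hj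
    have hKdeg : ∀ v ∈ S, v ≠ x → v ≠ y → d + 1 ≤ K.degree v + G.outDegree S v := by
      intro v hv hvx hvy
      exact (hHdeg v hv).trans_eq (congrArg (· + _) (degree_sdiff_edge_of_ne hvx hvy).symm)
    have hsubx := distLevel_subset_of_le_insideGraph hKH hxS
    have hsuby := distLevel_subset_of_le_insideGraph hKH hyS
    set L : ℕ → Finset V := fun i => K.distLevel x i ∪ K.distLevel y i with hL
    have hsub : ∀ i, L i ⊆ S := fun i => Finset.union_subset (hsubx i) (hsuby i)
    have hdis : ∀ i j, i ≤ t → j ≤ t → i ≠ j → Disjoint (L i) (L j) := by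
      intro i j hi hj hij
      simp only [hL, Finset.disjoint_union_left, Finset.disjoint_union_right]
      exact ⟨⟨disjoint_distLevel x hij, (hxy_dis j i hj hi).symm⟩,
        ⟨hxy_dis i j hi hj, disjoint_distLevel y hij⟩⟩
    have hcard : ∀ i ≤ t, (L i).card = (K.distLevel x i).card + (K.distLevel y i).card :=
      fun i hi => Finset.card_union_of_disjoint (hxy_dis i i hi hi)
    have hx0 : x ∈ K.distLevel x 0 := by simp [distLevel_zero]
    have hy0 : y ∈ K.distLevel y 0 := by simp [distLevel_zero]
    have hgrow : ∀ i, 1 ≤ i → i < t → d * (L i).card ≤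
        (L (i + 1)).card + ∑ v ∈ L i, G.outDegree S v := by
      intro i hi hit
      have hgi : ((2 * (i + 1) : ℕ) : ℕ∞) < K.egirth :=
        lt_of_lt_of_le (by exact_mod_cast (by omega : 2 * (i + 1) < 2 * t + 2)) hKgirth
      have h1 := mul_card_distLevel_le (d := d) (b := G.outDegree S) x hgi fun v hv =>
        hKdeg v (hsubx i hv)
          (fun h => Finset.disjoint_left.mp (disjoint_distLevel x (by omega)) (h ▸ hv) hx0)
          (fun h => Finset.disjoint_left.mp (hxy_dis i 0 hit.le (Nat.zero_le t)) (h ▸ hv) hy0)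
      have h2 := mul_card_distLevel_le (d := d) (b := G.outDegree S) y hgi fun v hv =>
        hKdeg v (hsuby i hv)
          (fun h => Finset.disjoint_left.mp (hxy_dis 0 i (Nat.zero_le t) hit.le) hx0 (h ▸ hv))
          (fun h => Finset.disjoint_left.mp (disjoint_distLevel y (by omega)) (h ▸ hv) hy0)
      rw [hcard i hit.le, hcard (i + 1) hit, Finset.sum_union (hxy_dis i i hit.le hit.le), mul_add]
      omega
    have h1 := nOneStar_even_le_sum (t := t) (d := d) (M := fun i => (L i).card)
      (β := fun i => ∑ v ∈ L i, G.outDegree S v) (by omega) (by omega)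
      (by rw [hcard 0 (Nat.zero_le t)]; simp [distLevel_zero])
      (by rw [hcard 1 (by omega), card_distLevel_one, card_distLevel_one]; omega)
      hgrow ((sum_sum_le_of_pairwiseDisjoint _ hsub hdis).trans hb')
    have h2 := sum_card_le_of_pairwiseDisjoint hsub hdis
    exact h1.trans (by exact_mod_cast h2)

end Size

end SimpleGraph

/-! ### The second eigenvalue and edges between two sets. -/

/-- Every pencil spanned by two vectors contains a nontrivial combination on which the quadratic
form of a real symmetric matrix is bounded by its second largest eigenvalue. -/
theorem Matrix.IsHermitian.exists_dotProduct_mulVec_le {n : Type*} [Fintype n] [DecidableEq n]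
    {A : Matrix n n ℝ} (hA : A.IsHermitian) (hn : 1 < Fintype.card n) (u v : n → ℝ) :
    ∃ α β : ℝ, (α ≠ 0 ∨ β ≠ 0) ∧
      (α • u + β • v) ⬝ᵥ (A.mulVec (α • u + β • v)) ≤
        hA.eigenvalues₀ ⟨1, hn⟩ * ((α • u + β • v) ⬝ᵥ (α • u + β • v)) := by
  set T := A.toEuclideanLin with hTdef
  have hT : T.IsSymmetric := Matrix.isSymmetric_toEuclideanLin_iff.mpr hA
  set b := hT.eigenvectorBasis finrank_euclideanSpace with hb
  let z : Fin (Fintype.card n) := ⟨0, by omega⟩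
  -- The combination is chosen orthogonal to the top eigenvector, so only eigenvalues from the
  -- second on contribute.
  obtain ⟨α, β, hne, hz⟩ : ∃ α β : ℝ, (α ≠ 0 ∨ β ≠ 0) ∧
      α * b.repr (WithLp.toLp 2 u) z + β * b.repr (WithLp.toLp 2 v) z = 0 := by
    by_cases h : b.repr (WithLp.toLp 2 u) z = 0
    · exact ⟨1, 0, Or.inl one_ne_zero, by rw [h]; ring⟩
    · exact ⟨-b.repr (WithLp.toLp 2 v) z, b.repr (WithLp.toLp 2 u) z, Or.inr h, by ring⟩
  refine ⟨α, β, hne, ?_⟩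
  set x := α • u + β • v with hx
  set w : EuclideanSpace ℝ n := WithLp.toLp 2 x with hw
  have hwz : b.repr w z = 0 := by
    have : w = α • WithLp.toLp 2 u + β • WithLp.toLp 2 v := rfl
    rw [this]
    simpa using hz
  have h1 : x ⬝ᵥ A.mulVec x = inner ℝ w (T w) := by
    rw [EuclideanSpace.inner_eq_star_dotProduct, dotProduct_comm]
    rfl
  have h2 : x ⬝ᵥ x = inner ℝ w w := by
    rw [EuclideanSpace.inner_eq_star_dotProduct]
    rfl
  have h3 : ∀ y : EuclideanSpace ℝ n, inner ℝ w y = ∑ i, b.repr w i * b.repr y i := by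
    intro y
    rw [← b.repr.inner_map_map w y, PiLp.inner_apply]
    exact Finset.sum_congr rfl fun i _ => by simp [mul_comm]
  rw [h1, h2, h3, h3, Finset.mul_sum]
  refine Finset.sum_le_sum fun i _ => ?_
  have h4 : b.repr (T w) i = hA.eigenvalues₀ i * b.repr w i := by
    exact hT.eigenvectorBasis_apply_self_apply finrank_euclideanSpace w i
  rw [h4]
  by_cases hi : i = z
  · rw [hi, hwz]; simp
  · have h5 : hA.eigenvalues₀ i ≤ hA.eigenvalues₀ ⟨1, hn⟩ := by
      refine hA.eigenvalues₀_antitone ?_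
      rw [Fin.le_def]
      have : (i : ℕ) ≠ 0 := fun h => hi (Fin.ext h)
      simp only
      omega
    nlinarith [mul_le_mul_of_nonneg_right h5 (mul_self_nonneg (b.repr w i))]

namespace SimpleGraph

variable {V : Type*} [Fintype V] [DecidableEq V] (G : SimpleGraph V) [DecidableRel G.Adj]

/-- The number of edges between `S` and `T`, for disjoint `S` and `T`. -/
def edgesBetween (S T : Finset V) : ℕ :=
  ∑ v ∈ S, ((G.neighborFinset v).filter (· ∈ T)).card

theorem edgesBetween_comm (S T : Finset V) : G.edgesBetween S T = G.edgesBetween T S := by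
  have h := Finset.sum_card_bipartiteAbove_eq_sum_card_bipartiteBelow (s := S) (t := T) G.Adj
  have h1 : ∀ v, (G.neighborFinset v).filter (· ∈ T) = T.bipartiteAbove G.Adj v := by
    intro v; ext w; simp [Finset.mem_bipartiteAbove, and_comm]
  have h2 : ∀ v, (G.neighborFinset v).filter (· ∈ S) = S.bipartiteBelow G.Adj v := by
    intro v; ext w; simp [Finset.mem_bipartiteBelow, and_comm, G.adj_comm]
  simp only [edgesBetween, h1, h2, h]

/-- The number of edges leaving `S`. -/
def edgesOut (S : Finset V) : ℕ := ∑ v ∈ S, G.outDegree S v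

variable {G} {S T : Finset V}

theorem sum_degree_sub_edgesOut_eq :
    ∑ v ∈ S, (((G.neighborFinset v).filter (· ∈ S)).card : ℝ) =
      ∑ v ∈ S, (G.degree v : ℝ) - G.edgesOut S := by
  rw [edgesOut, Nat.cast_sum, ← Finset.sum_sub_distrib]
  refine Finset.sum_congr rfl fun v _ => ?_
  have h := Finset.card_filter_add_card_filter_not (s := G.neighborFinset v) (· ∈ S)
  rw [card_neighborFinset_eq_degree] at h
  rw [eq_sub_iff_add_eq, outDegree]
  exact_mod_cast h

/-- The adjacency part counts degrees inside `S`, that is, total degree minus `edgesOut`; adding `a`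
times the degrees produces the factor `a + 1`. -/
theorem dotProduct_degAdjMatrix_mulVec (hST : Disjoint S T) (a α β : ℝ) {x : V → ℝ}
    (hx : ∀ v, x v = (if v ∈ S then α else 0) + if v ∈ T then β else 0) :
    x ⬝ᵥ ((degAdjMatrix G a).mulVec x) =
      α ^ 2 * ((a + 1) * ∑ v ∈ S, (G.degree v : ℝ) - G.edgesOut S) +
      β ^ 2 * ((a + 1) * ∑ v ∈ T, (G.degree v : ℝ) - G.edgesOut T) +
      2 * α * β * G.edgesBetween S T := by
  have hmul : ∀ v, (degAdjMatrix G a).mulVec x v = a * (G.degree v * x v) +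
      (α * ((G.neighborFinset v).filter (· ∈ S)).card +
        β * ((G.neighborFinset v).filter (· ∈ T)).card) := by
    intro v
    rw [degAdjMatrix, Matrix.add_mulVec, Matrix.smul_mulVec, Pi.add_apply, Pi.smul_apply,
      smul_eq_mul, degMatrix_mulVec_apply, adjMatrix_mulVec_apply]
    congr 1
    simp only [hx, Finset.sum_add_distrib, ← Finset.sum_filter, Finset.sum_const, nsmul_eq_mul]
    ring
  have hsum : ∀ y : V → ℝ, x ⬝ᵥ y = α * ∑ v ∈ S, y v + β * ∑ v ∈ T, y v := by
    intro y
    simp only [dotProduct, hx, add_mul, Finset.sum_add_distrib, ite_mul, zero_mul,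
      Finset.mul_sum, Finset.sum_ite_mem, Finset.univ_inter]
  have hxS : ∀ v ∈ S, x v = α := fun v hv => by
    rw [hx, if_pos hv, if_neg (Finset.disjoint_left.mp hST hv), add_zero]
  have hxT : ∀ v ∈ T, x v = β := fun v hv => by
    rw [hx, if_pos hv, if_neg (Finset.disjoint_right.mp hST hv), zero_add]
  have hS : ∑ v ∈ S, (degAdjMatrix G a).mulVec x v =
      α * ((a + 1) * ∑ v ∈ S, (G.degree v : ℝ) - G.edgesOut S) + β * G.edgesBetween S T := by
    have h1 : ∑ v ∈ S, (degAdjMatrix G a).mulVec x v = ∑ v ∈ S, (a * α * G.degree v +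
        (α * ((G.neighborFinset v).filter (· ∈ S)).card +
        β * ((G.neighborFinset v).filter (· ∈ T)).card)) :=
      Finset.sum_congr rfl fun v hv => by rw [hmul, hxS v hv]; ring
    rw [h1, Finset.sum_add_distrib, Finset.sum_add_distrib, ← Finset.mul_sum, ← Finset.mul_sum,
      ← Finset.mul_sum, sum_degree_sub_edgesOut_eq, edgesBetween, Nat.cast_sum]
    ring
  have hT : ∑ v ∈ T, (degAdjMatrix G a).mulVec x v =
      β * ((a + 1) * ∑ v ∈ T, (G.degree v : ℝ) - G.edgesOut T) + α * G.edgesBetween S T := by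
    have h1 : ∑ v ∈ T, (degAdjMatrix G a).mulVec x v = ∑ v ∈ T, (a * β * G.degree v +
        (α * ((G.neighborFinset v).filter (· ∈ S)).card +
        β * ((G.neighborFinset v).filter (· ∈ T)).card)) :=
      Finset.sum_congr rfl fun v hv => by rw [hmul, hxT v hv]; ring
    rw [h1, Finset.sum_add_distrib, Finset.sum_add_distrib, ← Finset.mul_sum, ← Finset.mul_sum,
      ← Finset.mul_sum, sum_degree_sub_edgesOut_eq, edgesBetween_comm, edgesBetween, Nat.cast_sum]
    ring
  rw [hsum, hS, hT]
  ring

/-- The second largest eigenvalue of `a D + A` controls the edges at two disjoint vertex sets. -/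
theorem exists_quadratic_le_lambdaDA (hST : Disjoint S T) (hS : S.Nonempty) (hT : T.Nonempty)
    {a : ℝ} (ha : -1 ≤ a) {δ : ℕ} (hδ : ∀ v, δ ≤ G.degree v) :
    ∃ α β : ℝ, (α ≠ 0 ∨ β ≠ 0) ∧
      α ^ 2 * ((a + 1) * δ * S.card - G.edgesOut S) +
        β ^ 2 * ((a + 1) * δ * T.card - G.edgesOut T) + 2 * α * β * G.edgesBetween S T ≤
      lambdaDA G a 2 * (α ^ 2 * S.card + β ^ 2 * T.card) := by
  -- With two vertices available, `lambdaDA G a 2` is a true eigenvalue and not the default `0`.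
  have hcard : 1 < Fintype.card V := by
    have h1 := Finset.card_le_univ (S ∪ T)
    rw [Finset.card_union_of_disjoint hST] at h1
    have := hS.card_pos
    have := hT.card_pos
    omega
  have hlam : lambdaDA G a 2 = (degAdjMatrix_isHermitian G a).eigenvalues₀ ⟨1, hcard⟩ :=
    dif_pos ⟨one_le_two, hcard⟩
  obtain ⟨α, β, hne, h⟩ := (degAdjMatrix_isHermitian G a).exists_dotProduct_mulVec_le hcard
    (fun v => if v ∈ S then 1 else 0) (fun v => if v ∈ T then 1 else 0)
  refine ⟨α, β, hne, ?_⟩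
  rw [← hlam] at h
  set x : V → ℝ := α • (fun v => if v ∈ S then (1 : ℝ) else 0) +
    β • (fun v => if v ∈ T then (1 : ℝ) else 0) with hxdef
  have hx : ∀ v, x v = (if v ∈ S then α else 0) + if v ∈ T then β else 0 := fun v => by
    simp [hxdef]
  have hxx : x ⬝ᵥ x = α ^ 2 * S.card + β ^ 2 * T.card := by
    have hv : ∀ v, x v * x v = (if v ∈ S then α ^ 2 else 0) + if v ∈ T then β ^ 2 else 0 := by
      intro v
      rw [hx]
      by_cases h1 : v ∈ S
      · have := Finset.disjoint_left.mp hST h1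
        simp [h1, this, sq]
      · by_cases h2 : v ∈ T <;> simp [h1, h2, sq]
    simp only [dotProduct, hv, Finset.sum_add_distrib, Finset.sum_ite_mem, Finset.univ_inter,
      Finset.sum_const, nsmul_eq_mul]
    ring
  rw [dotProduct_degAdjMatrix_mulVec hST a α β hx, hxx] at h
  have hdeg : ∀ U : Finset V, (a + 1) * δ * U.card ≤ (a + 1) * ∑ v ∈ U, (G.degree v : ℝ) := by
    intro U
    rw [mul_assoc]
    refine mul_le_mul_of_nonneg_left ?_ (by linarith)
    have h1 := Finset.card_nsmul_le_sum U (fun v => (G.degree v : ℝ)) δ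
      (fun v _ => by exact_mod_cast hδ v)
    rw [nsmul_eq_mul] at h1
    linarith
  have h1 := mul_le_mul_of_nonneg_left (hdeg S) (sq_nonneg α)
  have h2 := mul_le_mul_of_nonneg_left (hdeg T) (sq_nonneg β)
  linarith

/-- Two disjoint large vertex sets left by few edges are joined by many edges when the second
largest eigenvalue of `a D + A` is small. -/
theorem sub_edgesOut_lt_edgesBetween (hST : Disjoint S T) {a m N : ℝ} (ha : -1 ≤ a) {δ : ℕ}
    (hδ : ∀ v, δ ≤ G.degree v) (hN : 0 < N) (hSN : N ≤ S.card) (hTN : N ≤ T.card)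
    (hlam : lambdaDA G a 2 < (a + 1) * δ - m / N) (hle : G.edgesOut S ≤ G.edgesOut T)
    (hm : G.edgesOut T ≤ m) : m - G.edgesOut T < G.edgesBetween S T := by
  have hS : S.Nonempty := Finset.card_pos.mp (by exact_mod_cast hN.trans_le hSN)
  have hT : T.Nonempty := Finset.card_pos.mp (by exact_mod_cast hN.trans_le hTN)
  obtain ⟨α, β, hne, h⟩ := exists_quadratic_le_lambdaDA hST hS hT ha hδ
  set μ := (a + 1) * δ - lambdaDA G a 2 with hμ
  have hle' : (G.edgesOut S : ℝ) ≤ G.edgesOut T := by exact_mod_cast hle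
  have hm0 : 0 ≤ m := (Nat.cast_nonneg _).trans hm
  have hμm : m < μ * N := by
    rw [← div_lt_iff₀ hN]; linarith
  have hμ0 : 0 < μ := pos_of_mul_pos_left (hm0.trans_lt hμm) hN.le
  have hμS : m < μ * S.card := hμm.trans_le (mul_le_mul_of_nonneg_left hSN hμ0.le)
  have hμT : m < μ * T.card := hμm.trans_le (mul_le_mul_of_nonneg_left hTN hμ0.le)
  -- If `e ≤ m - edgesOut T ≤ m - edgesOut S`, the form in `h1` strictly exceeds `(α + β) ^ 2 * e ≥
  -- 0`, strictness coming from `(α, β) ≠ 0`.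
  by_contra! hcon
  set e : ℝ := (G.edgesBetween S T : ℝ)
  have he0 : 0 ≤ e := Nat.cast_nonneg _
  have h1 : α ^ 2 * (μ * S.card - G.edgesOut S) + β ^ 2 * (μ * T.card - G.edgesOut T) +
      2 * α * β * e ≤ 0 := by
    rw [hμ]; linarith
  have h2 : α ^ 2 * m + β ^ 2 * m < α ^ 2 * (μ * S.card) + β ^ 2 * (μ * T.card) := by
    rcases hne with hα | hβ
    · exact add_lt_add_of_lt_of_le (mul_lt_mul_of_pos_left hμS (by positivity))
        (mul_le_mul_of_nonneg_left hμT.le (sq_nonneg β))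
    · exact add_lt_add_of_le_of_lt (mul_le_mul_of_nonneg_left hμS.le (sq_nonneg α))
        (mul_lt_mul_of_pos_left hμT (by positivity))
  have h3 : α ^ 2 * G.edgesOut S ≤ α ^ 2 * G.edgesOut T :=
    mul_le_mul_of_nonneg_left hle' (sq_nonneg α)
  have h4 : (α ^ 2 + β ^ 2) * e ≤ (α ^ 2 + β ^ 2) * (m - G.edgesOut T) :=
    mul_le_mul_of_nonneg_left hcon (by positivity)
  have h5 : 0 ≤ (α + β) ^ 2 * e := by positivity
  nlinarith

end SimpleGraph

theorem nOneStar_pos {δ g : ℕ} (hδ : 1 ≤ δ) : 0 < nOneStar δ g := by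
  have h : (0 : ℝ) ≤ (δ : ℝ) - 1 := by
    have : (1 : ℝ) ≤ δ := by exact_mod_cast hδ
    linarith
  unfold nOneStar
  simp only
  split_ifs
  · have := Finset.sum_nonneg fun i (_ : i ∈ Finset.Icc 2 ((g - 1) / 2)) => pow_nonneg h i
    positivity
  · have := Finset.sum_nonneg fun i (_ : i ∈ Finset.Icc 1 ((g - 1) / 2 - 1)) => pow_nonneg h i
    have := pow_nonneg h ((g - 1) / 2)
    positivity

/-! ### Edge counts for the parts of a partition. -/

namespace SimpleGraph

variable {V ι : Type*}

/-- The fibre of `f` over `c`, as a finite set. -/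
def fiber [Fintype V] [DecidableEq ι] (f : V → ι) (c : ι) : Finset V := {v | f v = c}

theorem disjoint_fiber [Fintype V] [DecidableEq ι] {f : V → ι} {c c' : ι} (h : c ≠ c') :
    Disjoint (fiber f c) (fiber f c') := by
  rw [Finset.disjoint_left]
  intro v hv hv'
  simp only [fiber, Finset.mem_filter, Finset.mem_univ, true_and] at hv hv'
  exact h (hv.symm.trans hv')

variable [Fintype V] [DecidableEq V] [Fintype ι] [DecidableEq ι] {G : SimpleGraph V}
  [DecidableRel G.Adj]

theorem edgesOut_fiber (f : V → ι) (c : ι) :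
    G.edgesOut (fiber f c) =
      ∑ c' ∈ Finset.univ.erase c, G.edgesBetween (fiber f c) (fiber f c') := by
  simp only [edgesOut, edgesBetween, outDegree]
  rw [Finset.sum_comm]
  refine Finset.sum_congr rfl fun v _ => ?_
  rw [← Finset.card_biUnion fun i _ j _ hij =>
    Finset.disjoint_filter_filter' _ _ (by
      rw [Pi.disjoint_iff]
      intro w
      simp only [Prop.disjoint_iff]
      exact fun h => Finset.disjoint_left.mp (disjoint_fiber hij) h.1 h.2)]
  congr 1
  ext w
  simp [fiber, and_comm]

/-- The handshake lemma in `crossGraph`: the edges leaving a fibre at `v` make up the degree of `v`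
there. -/
theorem sum_edgesOut_fiber (f : V → ι) :
    ∑ c, G.edgesOut (fiber f c) = 2 * (G.crossGraph f).edgeSet.ncard := by
  classical
  rw [← coe_edgeFinset, Set.ncard_coe_finset, ← sum_degrees_eq_twice_card_edges,
    ← Finset.sum_fiberwise (s := Finset.univ) (g := f)]
  refine Finset.sum_congr rfl fun c _ => Finset.sum_congr rfl fun v hv => ?_
  have hv' : f v = c := by simpa using hv
  rw [outDegree, ← card_neighborFinset_eq_degree]
  congr 1
  ext w
  simp [fiber, crossGraph_adj, hv', eq_comm]

end SimpleGraph

/-! ### The main theorem. -/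

open SimpleGraph in
theorem theorem1p6 {V : Type*} [Fintype V] [DecidableEq V] (G : SimpleGraph V)
    [DecidableRel G.Adj] (g k δ : ℕ) (a : ℝ)
    (hg : 3 ≤ g) (hk : 2 ≤ k) (ha : -1 ≤ a)
    (hδ : G.minDegree = δ) (hδk : 2 * k ≤ δ) (hgirth : G.egirth = g)
    (hlam : lambdaDA G a 2 < (a + 1) * δ - (2 * k - 1) / nOneStar δ g) :
    (k : ℕ∞) ≤ treePackingNumber G := by
  classical
  have hdeg : ∀ v, δ ≤ G.degree v := fun v => hδ ▸ G.minDegree_le_degree v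
  have hne : Nonempty V := by
    by_contra hV
    rw [not_nonempty_iff] at hV
    have hac : G.IsAcyclic := fun v => hV.elim v
    rw [hac.egirth_eq_top] at hgirth
    exact ENat.natCast_ne_top g hgirth.symm
  suffices h : ∃ F : Fin k → SimpleGraph V, IsSpanningTreePacking G F from
    le_iSup₂ (f := fun (m : ℕ)
      (_ : m ∈ {m : ℕ | ∃ F : Fin m → SimpleGraph V, IsSpanningTreePacking G F}) => (m : ℕ∞)) k h
  refine exists_isSpanningTreePacking G k fun s => ?_
  by_contra! hlt
  set f : V → Quotient s := Quotient.mk s with hf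
  set D : Quotient s → ℕ := fun c => G.edgesOut (fiber f c) with hD
  have hsum : ∑ c, D c = 2 * (G.crossGraph f).edgeSet.ncard := sum_edgesOut_fiber f
  have hfne : ∀ c, (fiber f c).Nonempty := by
    intro c
    obtain ⟨v, hv⟩ := Quotient.exists_rep c
    exact ⟨v, by simpa [fiber] using hv⟩
  have hsize : ∀ c, D c < 2 * k → nOneStar δ g ≤ (fiber f c).card := fun c hc =>
    nOneStar_le_card hg hgirth.ge (hfne c) (by omega) (fun v _ => hdeg v) (hc.trans_le hδk)
  have hbetween : ∀ c c', c ≠ c' → D c ≤ D c' →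
      (2 * k : ℤ) - D c' ≤ G.edgesBetween (fiber f c) (fiber f c') := by
    intro c c' hcc hle
    -- The spectral lemma with `m = 2k - 1` gives a strict inequality between integers, which
    -- recovers the missing 1. If `D c' ≥ 2k`, the left side is nonpositive.
    by_cases hc' : D c' < 2 * k
    · have h := sub_edgesOut_lt_edgesBetween (disjoint_fiber hcc) ha hdeg
        (nOneStar_pos (δ := δ) (g := g) (by omega)) (hsize c (hle.trans_lt hc')) (hsize c' hc')
        hlam hle (by
          have : (D c' : ℝ) + 1 ≤ 2 * k := by exact_mod_cast hc'
          linarith)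
      have h1 : ((2 * k - 1 - D c' : ℤ) : ℝ) <
          ((G.edgesBetween (fiber f c) (fiber f c') : ℤ) : ℝ) := by push_cast; exact h
      have h2 := Int.cast_lt.mp h1
      omega
    · omega
  obtain ⟨c₀, -, hmin⟩ := Finset.exists_min_image Finset.univ D
    ⟨f hne.some, Finset.mem_univ _⟩
  -- The edges leaving `c₀` are split by the part they reach. Adding the term of `c₀` bounds the
  -- full sum by `2k`, whereas `hlt` makes it larger.
  have h1 : ∑ c ∈ Finset.univ.erase c₀, ((2 * k : ℤ) - D c) ≤ D c₀ := by
    have h2 : (D c₀ : ℤ) = ∑ c ∈ Finset.univ.erase c₀,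
        (G.edgesBetween (fiber f c₀) (fiber f c) : ℤ) := by
      rw [← Nat.cast_sum, ← edgesOut_fiber]
    rw [h2]
    exact Finset.sum_le_sum fun c hc =>
      hbetween c₀ c (Finset.ne_of_mem_erase hc).symm (hmin c (Finset.mem_univ c))
  have h2 := Finset.add_sum_erase Finset.univ (fun c => (2 * k : ℤ) - D c) (Finset.mem_univ c₀)
  have h3 : ∑ c, ((2 * k : ℤ) - D c) = 2 * ((k * Fintype.card (Quotient s) : ℕ) : ℤ) -
      ((2 * (G.crossGraph f).edgeSet.ncard : ℕ) : ℤ) := by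
    rw [Finset.sum_sub_distrib, ← Nat.cast_sum, hsum, Finset.sum_const, Finset.card_univ,
      nsmul_eq_mul]
    push_cast
    ring
  rw [h3] at h2
  rw [Nat.card_eq_fintype_card] at hlt
  omega
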